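/- Let $H$ be a complex Hilbert space (inner product linear in the first variable), $M\subseteq B(H)$ a von Neumann algebra and $\Gamma\in B(H)$ a self-adjoint unitary with $\Gamma M\Gamma=M$. For $x\in B(H)$ put $x_\pm=\tfrac12(x\pm\Gamma x\Gamma)$ and $\kappa_\Gamma(x)=x_++\Gamma x_-$; let $M^{\wr}=\kappa_\Gamma(M')$ be the twisted commutant, which is a von Neumann algebra with $\Gamma M^{\wr}\Gamma=M^{\wr}$. Both $M$ and $M^{\wr}$ are $\mathbb Z_2$-graded by $x\mapsto\Gamma x\Gamma$. Let $M\,\otimes_F\,M^{\wr}$ be the algebraic tensor product with the $*$-algebra structure determined by $(a\,\otimes_F\,b)(c\,\otimes_F\,d)=(-1)^{\partial b\,\partial c}\,ac\,\otimes_F\,bd$ (for $b,c$ homogeneous of degrees $\partial b,\partial c\in\{0,1\}$) and $(a\,\otimes_F\,b)^*=(1\,\otimes_F\,b^*)(a^*\,\otimes_F\,1)$, and let $M\,\otimes_{F,\max}^{\rm bin}M^{\wr}$ be its completion in the norm $\sup_\pi\|\pi(\cdot)\|$, the supremum being over all unital $*$-representations $\pi$ on Hilbert spaces whose restrictions to $M$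 and to $M^{\wr}$ are normal. Let $\xi\in H$ be a unit vector that is cyclic and separating for $M$, with $\Gamma\xi=\pm\xi$; let $\mu(a)=\langle a\xi,\xi\rangle$ for $a\in M$, and let $\delta_\xi$ be the diagonal state, i.e. the state on $M\,\otimes_{F,\max}^{\rm bin}M^{\wr}$ determined by $\delta_\xi(a\,\otimes_F\,b)=\langle ab\,\xi,\xi\rangle$ for $a\in M$, $b\in M^{\wr}$. Let $\varkappa:M\to M^{\wr}$ be a $*$-isomorphism and $\Psi:M\to M$ a unital positive linear map, and put $\Psi^{\varkappa}=\varkappa\circ\Psi\circ\varkappa^{-1}:M^{\wr}\to M^{\wr}$. If $\mu\circ\Psi=\mu$, the twisted dual of $\Psi$ is the unique linear map $\Psi^{\wr}:M^{\wr}\to M^{\wr}$ such that $$\langle\Psi^{\wr}(b)\,a\,\xi,\xi\rangle=\langle b\,\Psi(a)\,\xi,\xi\rangle\qquad(a\in M,\ b\in M^{\wr}).$$ One says that $\Psi$ satisfies fermionic standard quantum detailed balance with respect to $\mu$ and $\varkappa$ if $\mu\circ\Psi=\mu$ (so that $\Psi^{\wr}$ is defined) and $\Psi^{\wr}=\Psi^{\varkappa}$.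 Then $\Psi$ satisfies fermionic standard quantum detailed balance with respect to $\mu$ and $\varkappa$ if and only if $$\delta_\xi\big(a\,\otimes_F\,\Psi^{\varkappa}(b)\big)=\delta_\xi\big(\Psi(a)\,\otimes_F\,b\big)\qquad\text{for all }a\in M\text{ and }b\in M^{\wr}.$$ -/

import Mathlib

universe u

open scoped TensorProduct

/-- A von Neumann algebra `M` on the Hilbert space `H`, graded by the adjoint action of a
self-adjoint unitary `Γ` with `Γ M Γ = M`. -/
structure GradedVonNeumannAlgebra (H : Type u) [NormedAddCommGroup H] [InnerProductSpace ℂ H]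
    [CompleteSpace H] where
  /-- the von Neumann algebra `M` -/
  alg : VonNeumannAlgebra H
  /-- the self-adjoint unitary `Γ` -/
  Γ : H →L[ℂ] H
  star_Γ : star Γ = Γ
  Γ_mul_Γ : Γ * Γ = 1
  stable : ∀ a ∈ alg, Γ * a * Γ ∈ alg

noncomputable section

namespace GradedVonNeumannAlgebra

/-! ### Even and odd parts, Klein transformation, twisted commutant -/

section Operators

variable {H : Type u} [NormedAddCommGroup H] [InnerProductSpace ℂ H]

/-- The even part `a₊ = (a + Γ a Γ) / 2` of an operator. -/
def evenPart (Γ : H →L[ℂ] H) (a : H →L[ℂ] H) : H →L[ℂ] H := (2⁻¹ : ℂ) • (a + Γ * a * Γ)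

/-- The odd part `a₋ = (a - Γ a Γ) / 2` of an operator. -/
def oddPart (Γ : H →L[ℂ] H) (a : H →L[ℂ] H) : H →L[ℂ] H := (2⁻¹ : ℂ) • (a - Γ * a * Γ)

/-- The Klein transformation `κ_Γ(a) = a₊ + Γ a₋`. -/
def klein (Γ : H →L[ℂ] H) (a : H →L[ℂ] H) : H →L[ℂ] H := evenPart Γ a + Γ * oddPart Γ a

variable {Γ : H →L[ℂ] H}

theorem evenPart_add_oddPart (a : H →L[ℂ] H) : evenPart Γ a + oddPart Γ a = a := by
  simp only [evenPart, oddPart]; module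

theorem conj_conj (hΓ : Γ * Γ = 1) (a : H →L[ℂ] H) : Γ * (Γ * a * Γ) * Γ = a := by
  calc Γ * (Γ * a * Γ) * Γ = (Γ * Γ) * a * (Γ * Γ) := by noncomm_ring
    _ = a := by simp [hΓ]

theorem conj_evenPart (hΓ : Γ * Γ = 1) (a : H →L[ℂ] H) :
    Γ * evenPart Γ a * Γ = evenPart Γ a := by
  simp only [evenPart, mul_smul_comm, smul_mul_assoc, mul_add, add_mul, conj_conj hΓ]
  rw [add_comm]

theorem conj_oddPart (hΓ : Γ * Γ = 1) (a : H →L[ℂ] H) :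
    Γ * oddPart Γ a * Γ = -oddPart Γ a := by
  simp only [oddPart, mul_smul_comm, smul_mul_assoc, mul_sub, sub_mul, conj_conj hΓ]
  rw [← smul_neg, neg_sub]

theorem comm_of_conj (hΓ : Γ * Γ = 1) {a : H →L[ℂ] H} (h : Γ * a * Γ = a) : a * Γ = Γ * a := by
  calc a * Γ = (Γ * a * Γ) * Γ := by rw [h]
    _ = Γ * a * (Γ * Γ) := by noncomm_ring
    _ = Γ * a := by simp [hΓ]

theorem anticomm_of_conj (hΓ : Γ * Γ = 1) {a : H →L[ℂ] H} (h : Γ * a * Γ = -a) :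
    a * Γ = -(Γ * a) := by
  calc a * Γ = -(Γ * a * Γ) * Γ := by rw [h, neg_neg]
    _ = -(Γ * a * (Γ * Γ)) := by noncomm_ring
    _ = -(Γ * a) := by simp [hΓ]

theorem evenPart_eq {a b : H →L[ℂ] H} (ha : Γ * a * Γ = a) (hb : Γ * b * Γ = -b) :
    evenPart Γ (a + b) = a := by
  simp only [evenPart, mul_add, add_mul, ha, hb]; module

theorem oddPart_eq {a b : H →L[ℂ] H} (ha : Γ * a * Γ = a) (hb : Γ * b * Γ = -b) :
    oddPart Γ (a + b) = b := by
  simp only [oddPart, mul_add, add_mul, ha, hb]; module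

theorem conj_Γ_mul {b : H →L[ℂ] H} (hb : Γ * b * Γ = -b) :
    Γ * (Γ * b) * Γ = -(Γ * b) := by
  calc Γ * (Γ * b) * Γ = Γ * (Γ * b * Γ) := by noncomm_ring
    _ = -(Γ * b) := by rw [hb]; noncomm_ring

theorem klein_eq {a b : H →L[ℂ] H} (ha : Γ * a * Γ = a) (hb : Γ * b * Γ = -b) :
    klein Γ (a + b) = a + Γ * b := by
  rw [klein, evenPart_eq ha hb, oddPart_eq ha hb]

theorem klein_klein (hΓ : Γ * Γ = 1) (a : H →L[ℂ] H) : klein Γ (klein Γ a) = a := by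
  conv_lhs => rw [klein.eq_def Γ a]
  rw [klein_eq (conj_evenPart hΓ a) (conj_Γ_mul (conj_oddPart hΓ a)), ← mul_assoc, hΓ, one_mul,
    evenPart_add_oddPart]

/-- If `S` and `S'` are stable under `ad Γ`, commuting elements have commuting Klein transforms. -/
theorem klein_mul_klein_comm (hΓ : Γ * Γ = 1) {a y : H →L[ℂ] H}
    (h00 : evenPart Γ a * evenPart Γ y = evenPart Γ y * evenPart Γ a)
    (h01 : evenPart Γ a * oddPart Γ y = oddPart Γ y * evenPart Γ a)
    (h10 : oddPart Γ a * evenPart Γ y = evenPart Γ y * oddPart Γ a)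
    (h11 : oddPart Γ a * oddPart Γ y = oddPart Γ y * oddPart Γ a) :
    klein Γ a * klein Γ y = klein Γ y * klein Γ a := by
  have ha0 := comm_of_conj hΓ (conj_evenPart hΓ a)
  have ha1 := anticomm_of_conj hΓ (conj_oddPart hΓ a)
  have hy0 := comm_of_conj hΓ (conj_evenPart hΓ y)
  have hy1 := anticomm_of_conj hΓ (conj_oddPart hΓ y)
  simp only [klein]
  generalize evenPart Γ a = a0 at *
  generalize oddPart Γ a = a1 at *
  generalize evenPart Γ y = y0 at *
  generalize oddPart Γ y = y1 at *
  have e1 : (a0 + Γ * a1) * (y0 + Γ * y1)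
      = a0 * y0 + (a0 * Γ) * y1 + Γ * (a1 * y0) + Γ * (a1 * Γ) * y1 := by noncomm_ring
  have e2 : (y0 + Γ * y1) * (a0 + Γ * a1)
      = y0 * a0 + (y0 * Γ) * a1 + Γ * (y1 * a0) + Γ * (y1 * Γ) * a1 := by noncomm_ring
  have e3 : Γ * -(Γ * a1) * y1 = -((Γ * Γ) * (a1 * y1)) := by noncomm_ring
  have e4 : Γ * -(Γ * y1) * a1 = -((Γ * Γ) * (y1 * a1)) := by noncomm_ring
  rw [e1, e2, ha0, hy0, ha1, hy1, e3, e4, h00, h10, h11, mul_assoc Γ a0, h01, mul_assoc Γ y0]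
  abel

theorem klein_conj (hΓ : Γ * Γ = 1) (c : H →L[ℂ] H) :
    klein Γ (Γ * c * Γ) = Γ * klein Γ c * Γ := by
  have h1 : Γ * c * Γ = evenPart Γ c + -oddPart Γ c := by
    simp only [evenPart, oddPart]; module
  rw [h1, klein_eq (conj_evenPart hΓ c) (by rw [mul_neg, neg_mul, conj_oddPart hΓ]), klein,
    mul_add, add_mul, conj_evenPart hΓ, conj_Γ_mul (conj_oddPart hΓ c), mul_neg]

end Operators

variable {H : Type u} [NormedAddCommGroup H] [InnerProductSpace ℂ H] [CompleteSpace H]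

theorem evenPart_mem {Γ : H →L[ℂ] H} {S : VonNeumannAlgebra H} (hS : ∀ a ∈ S, Γ * a * Γ ∈ S) {a : H →L[ℂ] H}
    (ha : a ∈ S) : evenPart Γ a ∈ S :=
  S.toStarSubalgebra.smul_mem (add_mem ha (hS a ha)) _

theorem oddPart_mem {Γ : H →L[ℂ] H} {S : VonNeumannAlgebra H} (hS : ∀ a ∈ S, Γ * a * Γ ∈ S) {a : H →L[ℂ] H}
    (ha : a ∈ S) : oddPart Γ a ∈ S :=
  S.toStarSubalgebra.smul_mem (sub_mem ha (hS a ha)) _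

theorem commutant_stable (𝓜 : GradedVonNeumannAlgebra H) :
    ∀ y ∈ 𝓜.alg.commutant, 𝓜.Γ * y * 𝓜.Γ ∈ 𝓜.alg.commutant := by
  intro y hy
  rw [VonNeumannAlgebra.mem_commutant_iff] at hy ⊢
  intro a ha
  have h := hy _ (𝓜.stable a ha)
  have e1 : a * (𝓜.Γ * y * 𝓜.Γ) = (𝓜.Γ * 𝓜.Γ) * a * (𝓜.Γ * y * 𝓜.Γ) := by simp [𝓜.Γ_mul_Γ]
  have e2 : (𝓜.Γ * y * 𝓜.Γ) * a = (𝓜.Γ * y * 𝓜.Γ) * a * (𝓜.Γ * 𝓜.Γ) := by simp [𝓜.Γ_mul_Γ]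
  calc a * (𝓜.Γ * y * 𝓜.Γ) = 𝓜.Γ * ((𝓜.Γ * a * 𝓜.Γ) * y) * 𝓜.Γ := by rw [e1]; noncomm_ring
    _ = (𝓜.Γ * y * 𝓜.Γ) * a := by rw [h, e2]; noncomm_ring

/-- The twisted commutant `κ_Γ(M')` is the commutant of `κ_Γ(M)`. -/
theorem klein_image_commutant (𝓜 : GradedVonNeumannAlgebra H) :
    klein 𝓜.Γ '' (𝓜.alg.commutant : Set (H →L[ℂ] H)) =
      Set.centralizer (klein 𝓜.Γ '' (𝓜.alg : Set (H →L[ℂ] H))) := by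
  have hΓ := 𝓜.Γ_mul_Γ
  set Γ := 𝓜.Γ with hΓdef
  ext x
  constructor
  · rintro ⟨y, hy, rfl⟩ _ ⟨a, ha, rfl⟩
    have hy0 := evenPart_mem 𝓜.commutant_stable hy
    have hy1 := oddPart_mem 𝓜.commutant_stable hy
    have ha0 := evenPart_mem 𝓜.stable ha
    have ha1 := oddPart_mem 𝓜.stable ha
    rw [VonNeumannAlgebra.mem_commutant_iff] at hy0 hy1
    exact klein_mul_klein_comm hΓ (hy0 _ ha0) (hy1 _ ha0) (hy0 _ ha1) (hy1 _ ha1)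
  · intro hx
    refine ⟨klein Γ x, ?_, klein_klein hΓ x⟩
    rw [SetLike.mem_coe, VonNeumannAlgebra.mem_commutant_iff]
    intro a ha
    have key : ∀ c ∈ 𝓜.alg, klein Γ c * x = x * klein Γ c := fun c hc => hx _ ⟨c, hc, rfl⟩
    -- `x` commutes with `κ(c)` and with `κ(ad Γ c) = ad Γ (κ c)`
    have key2 : ∀ c ∈ 𝓜.alg, klein Γ c * (Γ * x * Γ) = (Γ * x * Γ) * klein Γ c := by
      intro c hc
      have h := key _ (𝓜.stable c hc)
      rw [← hΓdef, klein_conj hΓ] at h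
      have e1 : klein Γ c * (Γ * x * Γ) = (Γ * Γ) * klein Γ c * (Γ * x * Γ) := by simp [hΓ]
      have e2 : (Γ * x * Γ) * klein Γ c = (Γ * x * Γ) * klein Γ c * (Γ * Γ) := by simp [hΓ]
      calc klein Γ c * (Γ * x * Γ) = Γ * ((Γ * klein Γ c * Γ) * x) * Γ := by
            rw [e1]; noncomm_ring
        _ = (Γ * x * Γ) * klein Γ c := by rw [h, e2]; noncomm_ring
    have k0 : ∀ c ∈ 𝓜.alg, klein Γ c * evenPart Γ x = evenPart Γ x * klein Γ c := by
      intro c hc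
      simp only [evenPart, mul_smul_comm, smul_mul_assoc, mul_add, add_mul, key c hc, key2 c hc]
    have k1 : ∀ c ∈ 𝓜.alg, klein Γ c * oddPart Γ x = oddPart Γ x * klein Γ c := by
      intro c hc
      simp only [oddPart, mul_smul_comm, smul_mul_assoc, mul_sub, sub_mul, key c hc, key2 c hc]
    have split : ∀ c, evenPart Γ (klein Γ c) = evenPart Γ c ∧
        oddPart Γ (klein Γ c) = Γ * oddPart Γ c := fun c =>
      ⟨evenPart_eq (conj_evenPart hΓ c) (conj_Γ_mul (conj_oddPart hΓ c)),
        oddPart_eq (conj_evenPart hΓ c) (conj_Γ_mul (conj_oddPart hΓ c))⟩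
    have part : ∀ z : H →L[ℂ] H, (∀ c ∈ 𝓜.alg, klein Γ c * z = z * klein Γ c) →
        evenPart Γ (klein Γ a) * z = z * evenPart Γ (klein Γ a) ∧
        oddPart Γ (klein Γ a) * z = z * oddPart Γ (klein Γ a) := by
      intro z hz
      have h1 := hz a ha
      have h2 := hz _ (𝓜.stable a ha)
      rw [← hΓdef, klein_conj hΓ] at h2
      constructor
      · simp only [evenPart, mul_smul_comm, smul_mul_assoc, mul_add, add_mul, h1, h2]
      · simp only [oddPart, mul_smul_comm, smul_mul_assoc, mul_sub, sub_mul, h1, h2]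
    have := klein_mul_klein_comm (a := klein Γ a) (y := x) hΓ (part _ k0).1 (part _ k1).1
      (part _ k0).2 (part _ k1).2
    rwa [klein_klein hΓ] at this

theorem star_klein (𝓜 : GradedVonNeumannAlgebra H) (y : H →L[ℂ] H) :
    star (klein 𝓜.Γ y) = klein 𝓜.Γ (𝓜.Γ * star y * 𝓜.Γ) := by
  have hΓ := 𝓜.Γ_mul_Γ
  have hs := 𝓜.star_Γ
  have h0 : star (evenPart 𝓜.Γ y) = evenPart 𝓜.Γ (star y) := by
    simp [evenPart, hs, mul_assoc]
  have h1 : star (oddPart 𝓜.Γ y) = oddPart 𝓜.Γ (star y) := by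
    simp [oddPart, hs, mul_assoc]
  have h2 : 𝓜.Γ * star y * 𝓜.Γ = evenPart 𝓜.Γ (star y) + -oddPart 𝓜.Γ (star y) := by
    simp only [evenPart, oddPart]; module
  rw [h2, klein_eq (conj_evenPart hΓ _) (by rw [mul_neg, neg_mul, conj_oddPart hΓ]), klein, star_add,
    star_mul, hs, h0, h1, anticomm_of_conj hΓ (conj_oddPart hΓ _), mul_neg]

/-- The twisted commutant `κ_Γ(M')` as a von Neumann algebra. -/
def twistedCommutant (𝓜 : GradedVonNeumannAlgebra H) : VonNeumannAlgebra H where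
  carrier := klein 𝓜.Γ '' (𝓜.alg.commutant : Set (H →L[ℂ] H))
  mul_mem' {a b} ha hb := by
    rw [klein_image_commutant] at ha hb ⊢
    exact Set.mul_mem_centralizer ha hb
  add_mem' {a b} ha hb := by
    rw [klein_image_commutant] at ha hb ⊢
    exact Set.add_mem_centralizer ha hb
  algebraMap_mem' r := by
    rw [klein_image_commutant]
    exact fun x _ => (Algebra.commutes r x).symm
  star_mem' {a} ha := by
    obtain ⟨y, hy, rfl⟩ := ha
    exact ⟨_, 𝓜.commutant_stable _ (star_mem hy), (𝓜.star_klein y).symm⟩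
  centralizer_centralizer' := by
    rw [klein_image_commutant, Set.centralizer_centralizer_centralizer]

theorem mem_twistedCommutant (𝓜 : GradedVonNeumannAlgebra H) {x : H →L[ℂ] H} :
    x ∈ 𝓜.twistedCommutant ↔ klein 𝓜.Γ x ∈ 𝓜.alg.commutant := by
  constructor
  · rintro ⟨y, hy, rfl⟩
    rwa [klein_klein 𝓜.Γ_mul_Γ]
  · intro h
    exact ⟨_, h, klein_klein 𝓜.Γ_mul_Γ x⟩

/-- The twisted commutant `M^≀`, with the grading given by the same `Γ`. -/
def twist (𝓜 : GradedVonNeumannAlgebra H) : GradedVonNeumannAlgebra H where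
  alg := 𝓜.twistedCommutant
  Γ := 𝓜.Γ
  star_Γ := 𝓜.star_Γ
  Γ_mul_Γ := 𝓜.Γ_mul_Γ
  stable x hx := by
    obtain ⟨y, hy, rfl⟩ := hx
    exact ⟨_, 𝓜.commutant_stable y hy, klein_conj 𝓜.Γ_mul_Γ y⟩

/-! ### The algebraic Fermi tensor product -/

/-- The type of elements of `M`. -/
abbrev Elem (𝓜 : GradedVonNeumannAlgebra H) : Type u := 𝓜.alg.toStarSubalgebra

/-- The homogeneous components `M_i = {a | Γ a Γ = (-1)^i a}`, for `i ∈ ℤ/2`. -/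
def part (𝓜 : GradedVonNeumannAlgebra H) (i : ZMod 2) : Submodule ℂ 𝓜.Elem where
  carrier := {a | 𝓜.Γ * (a : H →L[ℂ] H) * 𝓜.Γ = ((-1 : ℤˣ) ^ i) • (a : H →L[ℂ] H)}
  add_mem' {a b} ha hb := by
    simp only [Set.mem_ofPred_eq] at ha hb ⊢
    simp only [AddMemClass.coe_add, mul_add, add_mul, ha, hb, smul_add]
  zero_mem' := by simp
  smul_mem' c a ha := by
    simp only [Set.mem_ofPred_eq] at ha ⊢
    simp only [SetLike.val_smul, mul_smul_comm, smul_mul_assoc, ha]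
    rw [smul_comm]

theorem mem_part_zero (𝓜 : GradedVonNeumannAlgebra H) {a : 𝓜.Elem} :
    a ∈ 𝓜.part 0 ↔ 𝓜.Γ * (a : H →L[ℂ] H) * 𝓜.Γ = a := by
  change _ = _ ↔ _
  rw [uzpow_zero, one_smul]

theorem mem_part_one (𝓜 : GradedVonNeumannAlgebra H) {a : 𝓜.Elem} :
    a ∈ 𝓜.part 1 ↔ 𝓜.Γ * (a : H →L[ℂ] H) * 𝓜.Γ = -a := by
  change _ = _ ↔ _
  rw [uzpow_one, Units.neg_smul, one_smul]

theorem star_mem_part (𝓜 : GradedVonNeumannAlgebra H) {i : ZMod 2} {a : 𝓜.Elem}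
    (ha : a ∈ 𝓜.part i) : star a ∈ 𝓜.part i := by
  change _ = _ at ha ⊢
  have h := congrArg star ha
  rcases Int.units_eq_one_or ((-1 : ℤˣ) ^ i) with h1 | h1 <;>
    simpa [h1, 𝓜.star_Γ, mul_assoc] using h

instance (𝓜 : GradedVonNeumannAlgebra H) : SetLike.GradedMonoid 𝓜.part where
  one_mem := by rw [mem_part_zero]; simp [𝓜.Γ_mul_Γ]
  mul_mem i j a b ha hb := by
    change _ = _ at ha hb ⊢
    calc 𝓜.Γ * ((a * b : 𝓜.Elem) : H →L[ℂ] H) * 𝓜.Γ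
        = 𝓜.Γ * (a : H →L[ℂ] H) * (𝓜.Γ * 𝓜.Γ) * (b : H →L[ℂ] H) * 𝓜.Γ := by
          rw [𝓜.Γ_mul_Γ, mul_one, MulMemClass.coe_mul]; noncomm_ring
      _ = (𝓜.Γ * (a : H →L[ℂ] H) * 𝓜.Γ) * (𝓜.Γ * (b : H →L[ℂ] H) * 𝓜.Γ) := by noncomm_ring
      _ = _ := by
          rw [ha, hb, uzpow_add, MulMemClass.coe_mul, smul_mul_smul_comm]

/-- The even part of an element of `M`, in `M`. -/
def evenElem (𝓜 : GradedVonNeumannAlgebra H) (a : 𝓜.Elem) : 𝓜.part 0 :=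
  ⟨⟨evenPart 𝓜.Γ a, evenPart_mem 𝓜.stable a.2⟩,
    𝓜.mem_part_zero.2 (conj_evenPart 𝓜.Γ_mul_Γ _)⟩

/-- The odd part of an element of `M`, in `M`. -/
def oddElem (𝓜 : GradedVonNeumannAlgebra H) (a : 𝓜.Elem) : 𝓜.part 1 :=
  ⟨⟨oddPart 𝓜.Γ a, oddPart_mem 𝓜.stable a.2⟩,
    𝓜.mem_part_one.2 (conj_oddPart 𝓜.Γ_mul_Γ _)⟩

theorem evenElem_add_oddElem (𝓜 : GradedVonNeumannAlgebra H) (a : 𝓜.Elem) :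
    (𝓜.evenElem a : 𝓜.Elem) + 𝓜.oddElem a = a :=
  Subtype.ext (evenPart_add_oddPart _)

instance (𝓜 : GradedVonNeumannAlgebra H) : GradedAlgebra 𝓜.part where
  decompose' a := DirectSum.of (fun i => 𝓜.part i) 0 (𝓜.evenElem a) +
    DirectSum.of (fun i => 𝓜.part i) 1 (𝓜.oddElem a)
  left_inv a := by
    simp only [map_add, DirectSum.coeAddMonoidHom_of]
    exact 𝓜.evenElem_add_oddElem a
  right_inv x := by
    induction x using DirectSum.induction_on with
    | zero =>
      have h0 : 𝓜.evenElem 0 = 0 := Subtype.ext (Subtype.ext (by simp [evenElem, evenPart]))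
      have h1 : 𝓜.oddElem 0 = 0 := Subtype.ext (Subtype.ext (by simp [oddElem, oddPart]))
      simp [h0, h1]
    | of i x =>
      rw [DirectSum.coeAddMonoidHom_of]
      obtain rfl | rfl := (by decide : ∀ i : ZMod 2, i = 0 ∨ i = 1) i
      · have hx := 𝓜.mem_part_zero.1 x.2
        have h0 : 𝓜.evenElem x = x :=
          Subtype.ext (Subtype.ext (by
            have := evenPart_eq (Γ := 𝓜.Γ) hx (b := 0) (by simp)
            simpa [evenElem] using this))
        have h1 : 𝓜.oddElem x = 0 :=
          Subtype.ext (Subtype.ext (by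
            have := oddPart_eq (Γ := 𝓜.Γ) hx (b := 0) (by simp)
            simpa [oddElem] using this))
        simp [h0, h1]
      · have hx := 𝓜.mem_part_one.1 x.2
        have h0 : 𝓜.evenElem x = 0 :=
          Subtype.ext (Subtype.ext (by
            have := evenPart_eq (Γ := 𝓜.Γ) (a := 0) (by simp) hx
            simpa [evenElem] using this))
        have h1 : 𝓜.oddElem x = x :=
          Subtype.ext (Subtype.ext (by
            have := oddPart_eq (Γ := 𝓜.Γ) (a := 0) (by simp) hx
            simpa [oddElem] using this))
        simp [h0, h1]
    | add x y hx hy =>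
      have h0 : ∀ a b, 𝓜.evenElem (a + b) = 𝓜.evenElem a + 𝓜.evenElem b := fun a b =>
        Subtype.ext (Subtype.ext (by simp [evenElem, evenPart, mul_add, add_mul]; abel))
      have h1 : ∀ a b, 𝓜.oddElem (a + b) = 𝓜.oddElem a + 𝓜.oddElem b := fun a b =>
        Subtype.ext (Subtype.ext (by simp [oddElem, oddPart, mul_add, add_mul, ← smul_add]; abel))
      dsimp only at hx hy ⊢
      rw [map_add, h0, h1, map_add, map_add]
      conv_rhs => rw [← hx, ← hy]
      abel

variable {H₁ H₂ : Type u} [NormedAddCommGroup H₁] [InnerProductSpace ℂ H₁] [CompleteSpace H₁]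
  [NormedAddCommGroup H₂] [InnerProductSpace ℂ H₂] [CompleteSpace H₂]

/-- The algebraic Fermi tensor product: the algebraic tensor product with the product
`(a ⓕ b)(c ⓕ d) = (-1)^(∂b ∂c) ac ⓕ bd` for homogeneous `b` and `c`. -/
abbrev FermiTensor (𝓜 : GradedVonNeumannAlgebra H₁) (𝓝 : GradedVonNeumannAlgebra H₂) : Type u :=
  GradedTensorProduct ℂ 𝓜.part 𝓝.part

namespace FermiTensor

variable {𝓜 : GradedVonNeumannAlgebra H₁} {𝓝 : GradedVonNeumannAlgebra H₂}

/-- The elementary tensor `a ⓕ b`. -/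
abbrev tmul (a : 𝓜.Elem) (b : 𝓝.Elem) : FermiTensor 𝓜 𝓝 := GradedTensorProduct.tmul ℂ a b

theorem add_tmul (a a' : 𝓜.Elem) (b : 𝓝.Elem) :
    (tmul (a + a') b : FermiTensor 𝓜 𝓝) = tmul a b + tmul a' b :=
  congrArg (GradedTensorProduct.of ℂ 𝓜.part 𝓝.part) (TensorProduct.add_tmul a a' b)

theorem tmul_add (a : 𝓜.Elem) (b b' : 𝓝.Elem) :
    (tmul a (b + b') : FermiTensor 𝓜 𝓝) = tmul a b + tmul a b' :=
  congrArg (GradedTensorProduct.of ℂ 𝓜.part 𝓝.part) (TensorProduct.tmul_add a b b')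

theorem smul_tmul (c : ℂ) (a : 𝓜.Elem) (b : 𝓝.Elem) :
    (tmul (c • a) b : FermiTensor 𝓜 𝓝) = c • tmul a b :=
  congrArg (GradedTensorProduct.of ℂ 𝓜.part 𝓝.part) (TensorProduct.smul_tmul' c a b).symm

theorem tmul_smul (c : ℂ) (a : 𝓜.Elem) (b : 𝓝.Elem) :
    (tmul a (c • b) : FermiTensor 𝓜 𝓝) = c • tmul a b :=
  congrArg (GradedTensorProduct.of ℂ 𝓜.part 𝓝.part) (TensorProduct.tmul_smul c a b)

theorem tmul_eq (a : 𝓜.Elem) (b : 𝓝.Elem) :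
    (tmul a b : FermiTensor 𝓜 𝓝) = tmul a 1 * tmul 1 b :=
  (GradedTensorProduct.tmul_one_mul_one_tmul 𝓜.part 𝓝.part a b).symm

theorem induction {P : FermiTensor 𝓜 𝓝 → Prop} (x : FermiTensor 𝓜 𝓝) (zero : P 0)
    (add : ∀ x y, P x → P y → P (x + y)) (tm : ∀ a b, P (tmul a b)) : P x := by
  have : ∀ y : 𝓜.Elem ⊗[ℂ] 𝓝.Elem, P (GradedTensorProduct.of ℂ 𝓜.part 𝓝.part y) := by
    intro y
    induction y using TensorProduct.induction_on with
    | zero => simpa using zero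
    | tmul a b => exact tm a b
    | add a b ha hb => rw [map_add]; exact add _ _ ha hb
  exact this ((GradedTensorProduct.of ℂ 𝓜.part 𝓝.part).symm x)

theorem hom_induction {P : FermiTensor 𝓜 𝓝 → Prop} (x : FermiTensor 𝓜 𝓝) (zero : P 0)
    (add : ∀ x y, P x → P y → P (x + y))
    (tm : ∀ i j (a : 𝓜.part i) (b : 𝓝.part j), P (tmul a b)) : P x := by
  refine induction x zero add fun a b => ?_
  rw [← 𝓜.evenElem_add_oddElem a, ← 𝓝.evenElem_add_oddElem b, add_tmul, tmul_add,
    tmul_add]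
  exact add _ _ (add _ _ (tm _ _ _ _) (tm _ _ _ _)) (add _ _ (tm _ _ _ _) (tm _ _ _ _))

/-- The conjugate-linear map with `a ⓕ b ↦ (1 ⓕ b*)(a* ⓕ 1)`, that is
`a ⓕ b ↦ (-1)^(∂a ∂b) a* ⓕ b*` for homogeneous `a` and `b`. -/
def starMap (𝓜 : GradedVonNeumannAlgebra H₁) (𝓝 : GradedVonNeumannAlgebra H₂) :
    FermiTensor 𝓜 𝓝 →ₗ⋆[ℂ] FermiTensor 𝓜 𝓝 :=
  (TensorProduct.lift (R := ℂ) (M := 𝓜.Elem) (N := 𝓝.Elem) (σ₁₂ := starRingEnd ℂ)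
    (P₂ := FermiTensor 𝓜 𝓝)
    (LinearMap.mk₂'ₛₗ (starRingEnd ℂ) (starRingEnd ℂ)
      (fun a b => (tmul 1 (star b) : FermiTensor 𝓜 𝓝) * tmul (star a) 1)
      (fun a a' b => by rw [star_add, add_tmul, mul_add])
      (fun c a b => by rw [star_smul, smul_tmul, mul_smul_comm]; rfl)
      (fun a b b' => by rw [star_add, tmul_add, add_mul])
      (fun c a b => by rw [star_smul, tmul_smul, smul_mul_assoc]; rfl))).comp
    (GradedTensorProduct.of ℂ 𝓜.part 𝓝.part).symm.toLinearMap

instance : Star (FermiTensor 𝓜 𝓝) := ⟨starMap 𝓜 𝓝⟩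

theorem star_tmul (a : 𝓜.Elem) (b : 𝓝.Elem) :
    star (tmul a b : FermiTensor 𝓜 𝓝) = tmul 1 (star b) * tmul (star a) 1 := rfl

theorem star_tmul_hom {i j : ZMod 2} (a : 𝓜.part i) (b : 𝓝.part j) :
    star (tmul (a : 𝓜.Elem) (b : 𝓝.Elem) : FermiTensor 𝓜 𝓝) =
      ((-1 : ℤˣ) ^ (j * i)) • tmul (star (a : 𝓜.Elem)) (star (b : 𝓝.Elem)) := by
  rw [star_tmul]
  have := GradedTensorProduct.tmul_coe_mul_coe_tmul (R := ℂ) 𝓜.part 𝓝.part 1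
    ⟨_, 𝓝.star_mem_part b.2⟩ ⟨_, 𝓜.star_mem_part a.2⟩ 1
  simpa using this

theorem star_units_smul (e : ℤˣ) (x : FermiTensor 𝓜 𝓝) : star (e • x) = e • star x := by
  rcases Int.units_eq_one_or e with rfl | rfl
  · simp
  · simp only [Units.neg_smul, one_smul]
    exact map_neg (starMap 𝓜 𝓝) x

instance : StarRing (FermiTensor 𝓜 𝓝) where
  star_involutive x := by
    refine hom_induction (P := fun x => star (star x) = x) x ?_ ?_ ?_
    · exact (congrArg _ (map_zero (starMap 𝓜 𝓝))).trans (map_zero (starMap 𝓜 𝓝))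
    · intro x y hx hy
      have h : star (x + y) = star x + star y := map_add (starMap 𝓜 𝓝) x y
      have h' : star (star x + star y) = star (star x) + star (star y) :=
        map_add (starMap 𝓜 𝓝) _ _
      rw [h, h', hx, hy]
    · intro i j a b
      rw [star_tmul_hom, star_units_smul]
      have := star_tmul_hom (𝓜 := 𝓜) (𝓝 := 𝓝) ⟨_, 𝓜.star_mem_part a.2⟩ ⟨_, 𝓝.star_mem_part b.2⟩
      rw [this, smul_smul, Int.units_mul_self, one_smul, star_star, star_star]
  star_mul x y := by
    have hadd : ∀ x y : FermiTensor 𝓜 𝓝, star (x + y) = star x + star y :=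
      fun x y => map_add (starMap 𝓜 𝓝) x y
    have hz : star (0 : FermiTensor 𝓜 𝓝) = 0 := map_zero (starMap 𝓜 𝓝)
    refine hom_induction (P := fun x => star (x * y) = star y * star x) x ?_ ?_ ?_
    · rw [zero_mul, hz, mul_zero]
    · intro x x' hx hx'
      rw [add_mul, hadd, hadd, mul_add, hx, hx']
    intro i j a b
    refine hom_induction (P := fun y => star (tmul (a : 𝓜.Elem) (b : 𝓝.Elem) * y) =
      star y * star (tmul (a : 𝓜.Elem) (b : 𝓝.Elem))) y ?_ ?_ ?_
    · rw [mul_zero, hz, zero_mul]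
    · intro x x' hx hx'
      rw [mul_add, hadd, hadd, add_mul, hx, hx']
    intro k l c d
    have h1 := GradedTensorProduct.tmul_coe_mul_coe_tmul (R := ℂ) 𝓜.part 𝓝.part
      (a : 𝓜.Elem) b c (d : 𝓝.Elem)
    have h2 := star_tmul_hom (𝓜 := 𝓜) (𝓝 := 𝓝)
      ⟨_, SetLike.GradedMul.mul_mem a.2 c.2⟩ ⟨_, SetLike.GradedMul.mul_mem b.2 d.2⟩
    have h3 := GradedTensorProduct.tmul_coe_mul_coe_tmul (R := ℂ) 𝓜.part 𝓝.part
      (star (c : 𝓜.Elem)) ⟨_, 𝓝.star_mem_part d.2⟩ ⟨_, 𝓜.star_mem_part a.2⟩ (star (b : 𝓝.Elem))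
    dsimp only at h1 h2 h3
    simp only [tmul] at h2 ⊢
    rw [h1, star_units_smul, h2, star_tmul_hom c d, star_tmul_hom a b, smul_mul_assoc,
      mul_smul_comm, tmul, h3, smul_smul, smul_smul, smul_smul, star_mul, star_mul]
    congr 1
    simp only [← uzpow_add]
    congr 1
    have key : ∀ i j k l : ZMod 2, j * k + (j + l) * (i + k) = l * k + j * i + l * i := by decide
    exact key i j k l
  star_add x y := map_add (starMap 𝓜 𝓝) x y

instance : StarModule ℂ (FermiTensor 𝓜 𝓝) where
  star_smul c x := (starMap 𝓜 𝓝).map_smulₛₗ c x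

end FermiTensor

/-! ### The maximal binormal norm and the Fermi `C*`-tensor product -/

/-- Normality (ultraweak continuity) of a map `ρ : M → B(K)`: every vector functional
`a ↦ ⟨ρ(a)v, w⟩` is of the form `a ↦ ∑ₙ ⟨a xₙ, yₙ⟩` with `∑ₙ ‖xₙ‖² < ∞` and `∑ₙ ‖yₙ‖² < ∞`. -/
def IsNormal (𝓜 : GradedVonNeumannAlgebra H) {K : Type u} [NormedAddCommGroup K]
    [InnerProductSpace ℂ K] (ρ : 𝓜.Elem → K →L[ℂ] K) : Prop :=
  ∀ v w : K, ∃ x y : ℕ → H, Summable (fun n => ‖x n‖ ^ 2) ∧ Summable (fun n => ‖y n‖ ^ 2) ∧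
    ∀ a : 𝓜.Elem, HasSum (fun n => inner ℂ (y n) ((a : H →L[ℂ] H) (x n))) (inner ℂ w (ρ a v))

theorem isClosed_alg (𝓜 : GradedVonNeumannAlgebra H) :
    IsClosed (𝓜.alg.toStarSubalgebra : Set (H →L[ℂ] H)) := by
  rw [VonNeumannAlgebra.coe_toStarSubalgebra, ← VonNeumannAlgebra.centralizer_centralizer]
  exact Set.isClosed_centralizer _

instance (𝓜 : GradedVonNeumannAlgebra H) : CompleteSpace 𝓜.Elem :=
  𝓜.isClosed_alg.completeSpace_coe

namespace FermiTensor

/-- A binormal representation: a unital `*`-representation of the algebraic Fermi tensor product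
whose restrictions to both factors are normal. -/
structure IsBinormal {𝓜 : GradedVonNeumannAlgebra H₁} {𝓝 : GradedVonNeumannAlgebra H₂} {K : Type u}
    [NormedAddCommGroup K] [InnerProductSpace ℂ K] [CompleteSpace K]
    (π : FermiTensor 𝓜 𝓝 →⋆ₐ[ℂ] (K →L[ℂ] K)) : Prop where
  left : 𝓜.IsNormal fun a => π (tmul a 1)
  right : 𝓝.IsNormal fun b => π (tmul 1 b)

/-- The set of the numbers `‖π(c)‖`, with `π` a binormal representation. -/
def binNormSet {𝓜 : GradedVonNeumannAlgebra H₁} {𝓝 : GradedVonNeumannAlgebra H₂}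
    (c : FermiTensor 𝓜 𝓝) : Set ℝ :=
  {r | ∃ (K : Type u) (_ : NormedAddCommGroup K) (_ : InnerProductSpace ℂ K) (_ : CompleteSpace K)
    (π : FermiTensor 𝓜 𝓝 →⋆ₐ[ℂ] (K →L[ℂ] K)), IsBinormal π ∧ r = ‖π c‖}

variable {𝓜 : GradedVonNeumannAlgebra H₁} {𝓝 : GradedVonNeumannAlgebra H₂}

theorem includeLeft_star (a : 𝓜.Elem) :
    (tmul (star a) 1 : FermiTensor 𝓜 𝓝) = star (tmul a 1) := by
  rw [star_tmul, star_one]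
  exact (one_mul _).symm

theorem includeRight_star (b : 𝓝.Elem) :
    (tmul 1 (star b) : FermiTensor 𝓜 𝓝) = star (tmul 1 b) := by
  rw [star_tmul, star_one]
  exact (mul_one _).symm

/-- The inclusion `a ↦ a ⓕ 1`. -/
def inclLeft : 𝓜.Elem →⋆ₐ[ℂ] FermiTensor 𝓜 𝓝 :=
  { GradedTensorProduct.includeLeft 𝓜.part 𝓝.part with map_star' := includeLeft_star }

/-- The inclusion `b ↦ 1 ⓕ b`. -/
def inclRight : 𝓝.Elem →⋆ₐ[ℂ] FermiTensor 𝓜 𝓝 :=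
  { GradedTensorProduct.includeRight 𝓜.part 𝓝.part with map_star' := includeRight_star }

theorem norm_hom_le (𝓜 : GradedVonNeumannAlgebra H) {K : Type u} [NormedAddCommGroup K]
    [InnerProductSpace ℂ K] [CompleteSpace K] (ρ : 𝓜.Elem →⋆ₐ[ℂ] (K →L[ℂ] K)) (a : 𝓜.Elem) :
    ‖ρ a‖ ≤ ‖a‖ := by
  let _ : CStarAlgebra 𝓜.Elem := { }
  exact NonUnitalStarAlgHom.norm_apply_le ρ a

theorem norm_tmul_le {K : Type u} [NormedAddCommGroup K] [InnerProductSpace ℂ K] [CompleteSpace K]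
    (π : FermiTensor 𝓜 𝓝 →⋆ₐ[ℂ] (K →L[ℂ] K)) (a : 𝓜.Elem) (b : 𝓝.Elem) :
    ‖π (tmul a b)‖ ≤ ‖a‖ * ‖b‖ := by
  rw [tmul_eq, map_mul]
  exact (norm_mul_le _ _).trans (mul_le_mul (norm_hom_le 𝓜 (π.comp inclLeft) a)
    (norm_hom_le 𝓝 (π.comp inclRight) b) (norm_nonneg _) (norm_nonneg _))

theorem bddAbove_binNormSet (c : FermiTensor 𝓜 𝓝) : BddAbove (binNormSet c) := by
  suffices h : ∃ C : ℝ, ∀ (K : Type u) (_ : NormedAddCommGroup K) (_ : InnerProductSpace ℂ K)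
      (_ : CompleteSpace K) (π : FermiTensor 𝓜 𝓝 →⋆ₐ[ℂ] (K →L[ℂ] K)), ‖π c‖ ≤ C by
    obtain ⟨C, hC⟩ := h
    refine ⟨C, ?_⟩
    rintro _ ⟨K, _, _, _, π, -, rfl⟩
    exact hC _ _ _ _ π
  refine induction (P := fun c => ∃ C : ℝ, ∀ (K : Type u) (_ : NormedAddCommGroup K)
      (_ : InnerProductSpace ℂ K) (_ : CompleteSpace K)
      (π : FermiTensor 𝓜 𝓝 →⋆ₐ[ℂ] (K →L[ℂ] K)), ‖π c‖ ≤ C) c ?_ ?_ ?_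
  · exact ⟨0, fun K _ _ _ π => by simp⟩
  · rintro x y ⟨C, hC⟩ ⟨D, hD⟩
    refine ⟨C + D, fun K _ _ _ π => ?_⟩
    rw [map_add]
    exact (norm_add_le _ _).trans (add_le_add (hC _ _ _ _ π) (hD _ _ _ _ π))
  · exact fun a b => ⟨‖a‖ * ‖b‖, fun K _ _ _ π => norm_tmul_le π a b⟩

/-- The maximal binormal norm, the supremum of `‖π(c)‖` over the binormal representations `π`. -/
def binNorm (c : FermiTensor 𝓜 𝓝) : ℝ := sSup (binNormSet c)

theorem binNorm_nonneg (c : FermiTensor 𝓜 𝓝) : 0 ≤ binNorm c :=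
  Real.sSup_nonneg (by rintro _ ⟨K, _, _, _, π, -, rfl⟩; exact norm_nonneg _)

theorem IsBinormal.norm_le {K : Type u} [NormedAddCommGroup K] [InnerProductSpace ℂ K]
    [CompleteSpace K] {π : FermiTensor 𝓜 𝓝 →⋆ₐ[ℂ] (K →L[ℂ] K)} (hπ : IsBinormal π)
    (c : FermiTensor 𝓜 𝓝) : ‖π c‖ ≤ binNorm c :=
  le_csSup (bddAbove_binNormSet c) ⟨K, _, _, _, π, hπ, rfl⟩

theorem binNorm_le {c : FermiTensor 𝓜 𝓝} {C : ℝ} (hC : 0 ≤ C)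
    (h : ∀ (K : Type u) (_ : NormedAddCommGroup K) (_ : InnerProductSpace ℂ K)
      (_ : CompleteSpace K) (π : FermiTensor 𝓜 𝓝 →⋆ₐ[ℂ] (K →L[ℂ] K)), IsBinormal π → ‖π c‖ ≤ C) :
    binNorm c ≤ C :=
  Real.sSup_le (by rintro _ ⟨K, _, _, _, π, hπ, rfl⟩; exact h _ _ _ _ π hπ) hC

theorem binNorm_smul_le (z : ℂ) (x : FermiTensor 𝓜 𝓝) : binNorm (z • x) ≤ ‖z‖ * binNorm x := by
  refine binNorm_le (mul_nonneg (norm_nonneg _) (binNorm_nonneg _)) fun K _ _ _ π hπ => ?_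
  rw [map_smul, norm_smul]
  exact mul_le_mul_of_nonneg_left (hπ.norm_le x) (norm_nonneg _)

/-- The maximal binormal norm as a seminorm. -/
def binSeminorm (𝓜 : GradedVonNeumannAlgebra H₁) (𝓝 : GradedVonNeumannAlgebra H₂) :
    Seminorm ℂ (FermiTensor 𝓜 𝓝) :=
  Seminorm.ofSMulLE binNorm
    (le_antisymm (binNorm_le le_rfl fun K _ _ _ π _ => by simp) (binNorm_nonneg _))
    (fun x y => binNorm_le (add_nonneg (binNorm_nonneg _) (binNorm_nonneg _))
      fun K _ _ _ π hπ => by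
        rw [map_add]
        exact (norm_add_le _ _).trans (add_le_add (hπ.norm_le x) (hπ.norm_le y)))
    binNorm_smul_le

instance : SeminormedRing (FermiTensor 𝓜 𝓝) :=
  { (binSeminorm 𝓜 𝓝).toAddGroupSeminorm.toSeminormedAddCommGroup,
    (inferInstance : Ring (FermiTensor 𝓜 𝓝)) with
    norm_mul_le := fun x y => binNorm_le (mul_nonneg (binNorm_nonneg _) (binNorm_nonneg _))
      fun K _ _ _ π hπ => by
        rw [map_mul]
        exact (norm_mul_le _ _).trans
          (mul_le_mul (hπ.norm_le x) (hπ.norm_le y) (norm_nonneg _) (binNorm_nonneg _)) }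

theorem norm_def (c : FermiTensor 𝓜 𝓝) : ‖c‖ = binNorm c := rfl

instance : NormedAlgebra ℂ (FermiTensor 𝓜 𝓝) where
  norm_smul_le := binNorm_smul_le

end FermiTensor

/-- The binormal Fermi tensor product of `M` and `N`: the completion of the algebraic Fermi tensor
product in the maximal binormal norm. -/
abbrev FermiCStar (𝓜 : GradedVonNeumannAlgebra H₁) (𝓝 : GradedVonNeumannAlgebra H₂) : Type u :=
  UniformSpace.Completion (FermiTensor 𝓜 𝓝)

/-- The elementary tensor `a ⓕ b` in the binormal Fermi tensor product. -/
def ftmul {𝓜 : GradedVonNeumannAlgebra H₁} {𝓝 : GradedVonNeumannAlgebra H₂} (a : 𝓜.Elem)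
    (b : 𝓝.Elem) : FermiCStar 𝓜 𝓝 :=
  ((FermiTensor.tmul a b : FermiTensor 𝓜 𝓝) : UniformSpace.Completion (FermiTensor 𝓜 𝓝))

/-! ### The diagonal state -/

theorem twist_even_mem (𝓜 : GradedVonNeumannAlgebra H) {b : 𝓜.twist.Elem}
    (hb : b ∈ 𝓜.twist.part 0) : (b : H →L[ℂ] H) ∈ 𝓜.alg.commutant := by
  have h := 𝓜.mem_twistedCommutant.1 b.2
  have hb' : 𝓜.Γ * (b : H →L[ℂ] H) * 𝓜.Γ = b := 𝓜.twist.mem_part_zero.1 hb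
  have := klein_eq hb' (b := 0) (by simp)
  simp only [add_zero, mul_zero] at this
  rwa [this] at h

theorem twist_odd_mem (𝓜 : GradedVonNeumannAlgebra H) {b : 𝓜.twist.Elem}
    (hb : b ∈ 𝓜.twist.part 1) : 𝓜.Γ * (b : H →L[ℂ] H) ∈ 𝓜.alg.commutant := by
  have h := 𝓜.mem_twistedCommutant.1 b.2
  have hb' : 𝓜.Γ * (b : H →L[ℂ] H) * 𝓜.Γ = -b := 𝓜.twist.mem_part_one.1 hb
  have := klein_eq (a := 0) (by simp) hb'
  simp only [zero_add] at this
  rwa [this] at h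

theorem anticommute (𝓜 : GradedVonNeumannAlgebra H) ⦃i j : ZMod 2⦄ (a : 𝓜.part i)
    (b : 𝓜.twist.part j) :
    ((a : 𝓜.Elem) : H →L[ℂ] H) * ((b : 𝓜.twist.Elem) : H →L[ℂ] H) =
      ((-1 : ℤˣ) ^ (j * i)) • (((b : 𝓜.twist.Elem) : H →L[ℂ] H) * ((a : 𝓜.Elem) : H →L[ℂ] H)) := by
  obtain rfl | rfl := (by decide : ∀ j : ZMod 2, j = 0 ∨ j = 1) j
  · have h := 𝓜.twist_even_mem b.2
    rw [VonNeumannAlgebra.mem_commutant_iff] at h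
    rw [zero_mul, uzpow_zero, one_smul, h _ (a : 𝓜.Elem).2]
  · have h := 𝓜.twist_odd_mem b.2
    rw [VonNeumannAlgebra.mem_commutant_iff] at h
    have h1 := h _ (a : 𝓜.Elem).2
    have ha : 𝓜.Γ * ((a : 𝓜.Elem) : H →L[ℂ] H) * 𝓜.Γ =
      ((-1 : ℤˣ) ^ i) • ((a : 𝓜.Elem) : H →L[ℂ] H) := a.2
    generalize ((a : 𝓜.Elem) : H →L[ℂ] H) = x at *
    generalize ((b : 𝓜.twist.Elem) : H →L[ℂ] H) = y at *
    have h2 : 𝓜.Γ * (x * (𝓜.Γ * y)) = y * x := by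
      rw [h1]
      calc 𝓜.Γ * (𝓜.Γ * y * x) = (𝓜.Γ * 𝓜.Γ) * (y * x) := by noncomm_ring
        _ = y * x := by rw [𝓜.Γ_mul_Γ, one_mul]
    rw [one_mul, ← h2, ← mul_assoc, ← mul_assoc, ha, smul_mul_assoc, smul_smul, Int.units_mul_self,
      one_smul]

/-- The `*`-representation of the algebraic Fermi tensor product of `M` and `M^≀` on `H` given by
`a ⓕ b ↦ ab`. -/
def diagRep (𝓜 : GradedVonNeumannAlgebra H) :
    FermiTensor 𝓜 𝓜.twist →⋆ₐ[ℂ] (H →L[ℂ] H) :=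
  { GradedTensorProduct.lift 𝓜.part 𝓜.twist.part 𝓜.alg.toStarSubalgebra.subtype.toAlgHom
      𝓜.twist.alg.toStarSubalgebra.subtype.toAlgHom 𝓜.anticommute with
    map_star' := fun x => by
      let f := GradedTensorProduct.lift 𝓜.part 𝓜.twist.part
        𝓜.alg.toStarSubalgebra.subtype.toAlgHom
        𝓜.twist.alg.toStarSubalgebra.subtype.toAlgHom 𝓜.anticommute
      change f (star x) = star (f x)
      refine FermiTensor.induction (P := fun x => f (star x) = star (f x)) x ?_ ?_ ?_
      · simp
      · intro x y hx hy
        rw [star_add, map_add, hx, hy, map_add, star_add]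
      · intro a b
        have hf : ∀ a b, f (FermiTensor.tmul a b) = (a : H →L[ℂ] H) * (b : H →L[ℂ] H) :=
          fun a b => rfl
        rw [FermiTensor.star_tmul, map_mul, hf, hf, hf]
        simp }

theorem diagRep_tmul (𝓜 : GradedVonNeumannAlgebra H) (a : 𝓜.Elem) (b : 𝓜.twist.Elem) :
    𝓜.diagRep (FermiTensor.tmul a b) = (a : H →L[ℂ] H) * (b : H →L[ℂ] H) := rfl

theorem isNormal_coe (𝓜 : GradedVonNeumannAlgebra H) :
    𝓜.IsNormal fun a => (a : H →L[ℂ] H) := by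
  intro v w
  refine ⟨fun n => if n = 0 then v else 0, fun n => if n = 0 then w else 0,
    summable_of_ne_finset_zero (s := {0}) ?_, summable_of_ne_finset_zero (s := {0}) ?_,
    fun a => ?_⟩
  · intro n hn; simp_all
  · intro n hn; simp_all
  · convert hasSum_single (f := fun n : ℕ => inner ℂ (if n = 0 then w else 0)
      ((a : H →L[ℂ] H) (if n = 0 then v else 0))) 0 (fun n hn => by simp [hn]) using 1
    simp

theorem isBinormal_diagRep (𝓜 : GradedVonNeumannAlgebra H) :
    FermiTensor.IsBinormal 𝓜.diagRep where
  left := by simpa [diagRep_tmul] using 𝓜.isNormal_coe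
  right := by simpa [diagRep_tmul] using 𝓜.twist.isNormal_coe

/-- The continuous extension of `diagRep` to the binormal Fermi tensor product. -/
def diagRepExt (𝓜 : GradedVonNeumannAlgebra H) : FermiCStar 𝓜 𝓜.twist →L[ℂ] (H →L[ℂ] H) :=
  (LinearMap.mkContinuous 𝓜.diagRep.toAlgHom.toLinearMap 1 fun c => by
    rw [one_mul]; exact 𝓜.isBinormal_diagRep.norm_le c).extend UniformSpace.Completion.toComplL

/-- The diagonal state `δ_ξ` on the binormal Fermi tensor product of `M` and `M^≀`, determined by
`δ_ξ(a ⓕ b) = ⟨abξ, ξ⟩`. -/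
def diagonalState (𝓜 : GradedVonNeumannAlgebra H) (ξ : H) : FermiCStar 𝓜 𝓜.twist →L[ℂ] ℂ :=
  (innerSL ℂ ξ).comp ((ContinuousLinearMap.apply ℂ H ξ).comp 𝓜.diagRepExt)

theorem diagonalState_ftmul (𝓜 : GradedVonNeumannAlgebra H) (ξ : H) (a : 𝓜.Elem)
    (b : 𝓜.twist.Elem) :
    𝓜.diagonalState ξ (ftmul a b) = inner ℂ ξ ((a : H →L[ℂ] H) ((b : H →L[ℂ] H) ξ)) := by
  have h : 𝓜.diagRepExt (ftmul a b) = (a : H →L[ℂ] H) * (b : H →L[ℂ] H) :=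
    ContinuousLinearMap.extend_eq _ (UniformSpace.Completion.denseRange_coe)
      (UniformSpace.Completion.isUniformInducing_coe _) _
  simp [diagonalState, h]

/-! ### Twisted dual and fermionic standard quantum detailed balance -/

/-- A unit vector `ξ` which is cyclic and separating for `M`, with `Γξ = ±ξ`. -/
structure IsStandardVector (𝓜 : GradedVonNeumannAlgebra H) (ξ : H) : Prop where
  norm_eq_one : ‖ξ‖ = 1
  even : 𝓜.Γ ξ = ξ ∨ 𝓜.Γ ξ = -ξ
  cyclic : DenseRange fun a : 𝓜.Elem => (a : H →L[ℂ] H) ξ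
  separating : ∀ a : 𝓜.Elem, (a : H →L[ℂ] H) ξ = 0 → a = 0

/-- The linear map `Ψ` on `M` is positive. -/
def IsPositiveMap (𝓜 : GradedVonNeumannAlgebra H) (Ψ : 𝓜.Elem →ₗ[ℂ] 𝓜.Elem) : Prop :=
  ∀ a : 𝓜.Elem, (a : H →L[ℂ] H).IsPositive → (Ψ a : H →L[ℂ] H).IsPositive

/-- The state `μ(a) = ⟨aξ, ξ⟩` on `M`. -/
def vectorState (𝓜 : GradedVonNeumannAlgebra H) (ξ : H) (a : 𝓜.Elem) : ℂ :=
  inner ℂ ξ ((a : H →L[ℂ] H) ξ)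

/-- `Φ` is a twisted dual of `Ψ`: `⟨Φ(b)aξ, ξ⟩ = ⟨bΨ(a)ξ, ξ⟩` for `a ∈ M` and `b ∈ M^≀`. -/
def IsTwistedDual (𝓜 : GradedVonNeumannAlgebra H) (ξ : H) (Ψ : 𝓜.Elem →ₗ[ℂ] 𝓜.Elem)
    (Φ : 𝓜.twist.Elem →ₗ[ℂ] 𝓜.twist.Elem) : Prop :=
  ∀ (a : 𝓜.Elem) (b : 𝓜.twist.Elem),
    inner ℂ ξ ((Φ b : H →L[ℂ] H) ((a : H →L[ℂ] H) ξ)) =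
      inner ℂ ξ ((b : H →L[ℂ] H) ((Ψ a : H →L[ℂ] H) ξ))

section Existence

variable {𝓜 : GradedVonNeumannAlgebra H} {ξ : H}

/-- The orbit map `a ↦ aξ`. -/
def orbit (𝓜 : GradedVonNeumannAlgebra H) (ξ : H) : 𝓜.Elem →ₗ[ℂ] H where
  toFun a := (a : H →L[ℂ] H) ξ
  map_add' a b := by simp
  map_smul' c a := by simp

theorem isPositive_star_mul (c : 𝓜.Elem) :
    ((star c * c : 𝓜.Elem) : H →L[ℂ] H).IsPositive := by
  have := ContinuousLinearMap.isPositive_adjoint_comp_self (c : H →L[ℂ] H)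
  simpa [ContinuousLinearMap.star_eq_adjoint, ContinuousLinearMap.mul_def] using this

/-- Commuting positive operators have a positive product, in quadratic form. -/
theorem inner_mul_nonneg {b p : H →L[ℂ] H} (hb : b.IsPositive) (hp : p.IsPositive)
    (hbp : Commute b p) : (b * p).IsPositive := by
  rw [← ContinuousLinearMap.nonneg_iff_isPositive] at hb hp ⊢
  exact hbp.mul_nonneg hb hp

theorem isPositive_norm_sub {s : H →L[ℂ] H} (hs : IsSelfAdjoint s) :
    (algebraMap ℂ (H →L[ℂ] H) ‖s‖ - s).IsPositive := by
  rw [← ContinuousLinearMap.nonneg_iff_isPositive, sub_nonneg]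
  exact hs.le_algebraMap_norm_self

theorem isPositive_algebraMap {r : ℝ} (hr : 0 ≤ r) :
    (algebraMap ℂ (H →L[ℂ] H) r).IsPositive := by
  rw [← ContinuousLinearMap.nonneg_iff_isPositive]
  have e : algebraMap ℂ (H →L[ℂ] H) r = algebraMap ℝ (H →L[ℂ] H) r := rfl
  rw [e]
  exact algebraMap_nonneg (H →L[ℂ] H) hr

theorem map_star_of_positive {Ψ : 𝓜.Elem →ₗ[ℂ] 𝓜.Elem} (hΨ : 𝓜.IsPositiveMap Ψ) (a : 𝓜.Elem) :
    Ψ (star a) = star (Ψ a) := by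
  have hsa : ∀ s : 𝓜.Elem, IsSelfAdjoint s → star (Ψ s) = Ψ s := by
    intro s hs
    have hs' : IsSelfAdjoint (s : H →L[ℂ] H) := congrArg Subtype.val hs
    have h1 := hΨ (algebraMap ℂ 𝓜.Elem ‖(s : H →L[ℂ] H)‖ - s) (isPositive_norm_sub hs')
    have h2 := hΨ (algebraMap ℂ 𝓜.Elem ‖(s : H →L[ℂ] H)‖) (isPositive_algebraMap (norm_nonneg _))
    have h3 : Ψ s = Ψ (algebraMap ℂ 𝓜.Elem ‖(s : H →L[ℂ] H)‖) -
        Ψ (algebraMap ℂ 𝓜.Elem ‖(s : H →L[ℂ] H)‖ - s) := by rw [← map_sub, sub_sub_cancel]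
    rw [h3, star_sub]
    exact congrArg₂ _ (Subtype.ext h2.isSelfAdjoint) (Subtype.ext h1.isSelfAdjoint)
  have h := realPart_add_I_smul_imaginaryPart a
  rw [← h, star_add, star_smul, (realPart a).2, (imaginaryPart a).2, map_add, map_add, map_smul,
    map_smul, star_add, star_smul, hsa _ (realPart a).2, hsa _ (imaginaryPart a).2]

/-- Radon-Nikodym in the commutant. -/
theorem exists_commutant_dual_pos (hξ : 𝓜.IsStandardVector ξ) {Ψ : 𝓜.Elem →ₗ[ℂ] 𝓜.Elem}
    (hΨ : 𝓜.IsPositiveMap Ψ) (hμ : ∀ a, 𝓜.vectorState ξ (Ψ a) = 𝓜.vectorState ξ a)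
    {b : H →L[ℂ] H} (hb : b ∈ 𝓜.alg.commutant) (hpos : b.IsPositive) :
    ∃ T ∈ 𝓜.alg.commutant, ∀ a : 𝓜.Elem, inner ℂ ξ (T ((a : H →L[ℂ] H) ξ)) =
      inner ℂ ξ (b ((Ψ a : H →L[ℂ] H) ξ)) := by
  have hcomm := VonNeumannAlgebra.mem_commutant_iff.1 hb
  -- the functional `φ(x) = ⟨b Ψ(x) ξ, ξ⟩`
  let φ : 𝓜.Elem →ₗ[ℂ] ℂ :=
    { toFun := fun x => inner ℂ ξ (b ((Ψ x : H →L[ℂ] H) ξ))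
      map_add' := fun x y => by simp
      map_smul' := fun c x => by simp }
  have φ_def : ∀ x, φ x = inner ℂ ξ (b ((Ψ x : H →L[ℂ] H) ξ)) := fun _ => rfl
  have φ_pos : ∀ c, 0 ≤ (φ (star c * c)).re := by
    intro c
    have h := inner_mul_nonneg hpos (hΨ _ (isPositive_star_mul c)) (hcomm _ (Ψ (star c * c)).2).symm
    exact h.re_inner_nonneg_right ξ
  have φ_star : ∀ x, φ (star x) = star (φ x) := by
    intro x
    have hbs : star b = b := hpos.isSelfAdjoint
    rw [φ_def, φ_def, map_star_of_positive hΨ]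
    have e : (star (Ψ x) : 𝓜.Elem) = (star (Ψ x : H →L[ℂ] H) : H →L[ℂ] H) := rfl
    rw [e, ContinuousLinearMap.star_eq_adjoint]
    have hc : b (ContinuousLinearMap.adjoint (Ψ x : H →L[ℂ] H) ξ) =
        ContinuousLinearMap.adjoint (Ψ x : H →L[ℂ] H) (b ξ) :=
      (DFunLike.congr_fun (hcomm _ (star (Ψ x)).2) ξ).symm
    have hbs' : ContinuousLinearMap.adjoint b = b := hbs
    rw [hc, ContinuousLinearMap.adjoint_inner_right, ← ContinuousLinearMap.adjoint_inner_left, hbs']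
    exact (inner_conj_symm _ _).symm
  have φ_le : ∀ c : 𝓜.Elem, (φ (star c * c)).re ≤ ‖b‖ * ‖(c : H →L[ℂ] H) ξ‖ ^ 2 := by
    intro c
    have h1 : Commute (algebraMap ℂ (H →L[ℂ] H) ‖b‖ - b) (Ψ (star c * c) : H →L[ℂ] H) :=
      Commute.sub_left (Algebra.commutes _ _) (hcomm _ (Ψ (star c * c)).2).symm
    have h2 := (inner_mul_nonneg (isPositive_norm_sub hpos.isSelfAdjoint)
      (hΨ _ (isPositive_star_mul c)) h1).re_inner_nonneg_right ξ
    have h3 := hμ (star c * c)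
    have h4 : 𝓜.vectorState ξ (star c * c) = (‖(c : H →L[ℂ] H) ξ‖ ^ 2 : ℝ) := by
      change inner ℂ ξ (ContinuousLinearMap.adjoint (c : H →L[ℂ] H) ((c : H →L[ℂ] H) ξ)) = _
      rw [ContinuousLinearMap.adjoint_inner_right, inner_self_eq_norm_sq_to_K]
      simp
    rw [h4] at h3
    have h5 : inner ℂ ξ (((algebraMap ℂ (H →L[ℂ] H) ‖b‖ - b) * (Ψ (star c * c) : H →L[ℂ] H)) ξ) =
        (‖b‖ : ℂ) * 𝓜.vectorState ξ (Ψ (star c * c)) - φ (star c * c) := by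
      rw [φ_def, vectorState, sub_mul, sub_apply, inner_sub_right,
        Algebra.algebraMap_eq_smul_one, smul_mul_assoc, one_mul, smul_apply,
        inner_smul_right]
      rfl
    rw [h5, h3, ← Complex.ofReal_mul] at h2
    rw [map_sub] at h2
    have h6 : RCLike.re ((‖b‖ * ‖(c : H →L[ℂ] H) ξ‖ ^ 2 : ℝ) : ℂ) = ‖b‖ * ‖(c : H →L[ℂ] H) ξ‖ ^ 2 :=
      Complex.ofReal_re _
    rw [h6] at h2
    change 0 ≤ _ - (φ (star c * c)).re at h2
    linarith
  have cs : ∀ a c : 𝓜.Elem, ‖φ (star a * c)‖ ≤ ‖b‖ * ‖(a : H →L[ℂ] H) ξ‖ * ‖(c : H →L[ℂ] H) ξ‖ := by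
    intro a c
    let core : PreInnerProductSpace.Core ℂ 𝓜.Elem :=
      { inner := fun a c => φ (star a * c)
        conj_inner_symm := fun a c => by
          change star (φ (star c * a)) = φ (star a * c)
          rw [← φ_star, star_mul, star_star]
        re_inner_nonneg := φ_pos
        add_left := fun a a' c => by rw [star_add, add_mul, map_add]
        smul_left := fun a c z => by rw [star_smul, smul_mul_assoc, map_smul]; rfl }
    have h := InnerProductSpace.Core.inner_mul_inner_self_le (c := core) a c
    have h' : ‖φ (star a * c)‖ * ‖φ (star c * a)‖ ≤ (φ (star a * a)).re * (φ (star c * c)).re := h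
    have hsymm : ‖φ (star c * a)‖ = ‖φ (star a * c)‖ := by
      rw [← norm_star (φ (star a * c)), ← φ_star, star_mul, star_star]
    rw [hsymm] at h'
    have h2 : (φ (star a * a)).re * (φ (star c * c)).re ≤
        (‖b‖ * ‖(a : H →L[ℂ] H) ξ‖ ^ 2) * (‖b‖ * ‖(c : H →L[ℂ] H) ξ‖ ^ 2) :=
      mul_le_mul (φ_le a) (φ_le c) (φ_pos c) (by positivity)
    refine abs_le_of_sq_le_sq' ?_ (by positivity) |>.2
    nlinarith [h', h2]
  have hd : DenseRange (orbit 𝓜 ξ) := hξ.cyclic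
  let g : 𝓜.Elem → (H →L[ℂ] ℂ) := fun a =>
    (φ.comp (LinearMap.mulLeft ℂ (star a))).extendOfNorm (orbit 𝓜 ξ)
  have hg : ∀ a c : 𝓜.Elem, g a ((c : H →L[ℂ] H) ξ) = φ (star a * c) := fun a c =>
    LinearMap.extendOfNorm_eq (f := φ.comp (LinearMap.mulLeft ℂ (star a))) (e := orbit 𝓜 ξ) hd
      ⟨‖b‖ * ‖(a : H →L[ℂ] H) ξ‖, fun c => cs a c⟩ c
  let v : 𝓜.Elem → H := fun a => (InnerProductSpace.toDual ℂ H).symm (g a)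
  have hv : ∀ a c : 𝓜.Elem, inner ℂ (v a) ((c : H →L[ℂ] H) ξ) = φ (star a * c) := by
    intro a c
    rw [InnerProductSpace.toDual_symm_apply, hg]
  have ext_inner : ∀ x y : H, (∀ c : 𝓜.Elem, inner ℂ x ((c : H →L[ℂ] H) ξ) =
      inner ℂ y ((c : H →L[ℂ] H) ξ)) → x = y := by
    intro x y h
    refine ext_inner_right ℂ fun z => ?_
    refine hd.induction_on z (isClosed_eq (by fun_prop) (by fun_prop)) h
  let V : 𝓜.Elem →ₗ[ℂ] H :=
    { toFun := v
      map_add' := fun a a' => ext_inner _ _ fun c => by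
        rw [inner_add_left, hv, hv, hv, star_add, add_mul, map_add]
      map_smul' := fun z a => ext_inner _ _ fun c => by
        rw [inner_smul_left, hv, hv, star_smul, smul_mul_assoc, map_smul]; rfl }
  have V_le : ∀ a, ‖V a‖ ≤ ‖b‖ * ‖orbit 𝓜 ξ a‖ := by
    intro a
    change ‖(InnerProductSpace.toDual ℂ H).symm (g a)‖ ≤ _
    rw [LinearIsometryEquiv.norm_map]
    exact LinearMap.opNorm_extendOfNorm_le hd (by positivity) fun c => cs a c
  let T : H →L[ℂ] H := V.extendOfNorm (orbit 𝓜 ξ)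
  have hT : ∀ a : 𝓜.Elem, T ((a : H →L[ℂ] H) ξ) = v a := fun a =>
    LinearMap.extendOfNorm_eq (f := V) (e := orbit 𝓜 ξ) hd ⟨_, V_le⟩ a
  have hTmem : T ∈ 𝓜.alg.commutant := by
    rw [VonNeumannAlgebra.mem_commutant_iff]
    intro d hd'
    ext z
    refine hd.induction_on z (isClosed_eq (by fun_prop) (by fun_prop)) fun a => ?_
    change d (T ((a : H →L[ℂ] H) ξ)) = T ((((⟨d, hd'⟩ * a : 𝓜.Elem)) : H →L[ℂ] H) ξ)
    rw [hT, hT]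
    refine ext_inner _ _ fun c => ?_
    rw [hv, ← ContinuousLinearMap.adjoint_inner_right]
    have := hv a (star (⟨d, hd'⟩ : 𝓜.Elem) * c)
    rw [star_mul, mul_assoc, ← this]
    rfl
  refine ⟨star T, star_mem hTmem, fun a => ?_⟩
  rw [ContinuousLinearMap.star_eq_adjoint, ContinuousLinearMap.adjoint_inner_right]
  have h1 := hT 1
  have h2 := hv 1 a
  rw [star_one, one_mul] at h2
  rw [← φ_def, ← h2, ← h1]
  rfl

theorem exists_commutant_dual (hξ : 𝓜.IsStandardVector ξ) {Ψ : 𝓜.Elem →ₗ[ℂ] 𝓜.Elem}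
    (hΨ : 𝓜.IsPositiveMap Ψ) (hμ : ∀ a, 𝓜.vectorState ξ (Ψ a) = 𝓜.vectorState ξ a)
    {b : H →L[ℂ] H} (hb : b ∈ 𝓜.alg.commutant) :
    ∃ T ∈ 𝓜.alg.commutant, ∀ a : 𝓜.Elem, inner ℂ ξ (T ((a : H →L[ℂ] H) ξ)) =
      inner ℂ ξ (b ((Ψ a : H →L[ℂ] H) ξ)) := by
  let S := 𝓜.alg.commutant.toStarSubalgebra
  have real_smul_mem : ∀ (t : ℝ) {x : H →L[ℂ] H}, x ∈ 𝓜.alg.commutant → t • x ∈ 𝓜.alg.commutant :=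
    fun t x hx => by
      have h := S.smul_mem hx (t : ℂ)
      rwa [Complex.coe_smul] at h
  let P : (H →L[ℂ] H) → Prop := fun b => ∃ T ∈ 𝓜.alg.commutant, ∀ a : 𝓜.Elem,
    inner ℂ ξ (T ((a : H →L[ℂ] H) ξ)) = inner ℂ ξ (b ((Ψ a : H →L[ℂ] H) ξ))
  have hadd : ∀ b c, P b → P c → P (b + c) := by
    rintro b c ⟨T, hT, h⟩ ⟨T', hT', h'⟩
    exact ⟨T + T', add_mem hT hT', fun a => by simp [h, h']⟩
  have hsmul : ∀ (z : ℂ) b, P b → P (z • b) := by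
    rintro z b ⟨T, hT, h⟩
    exact ⟨z • T, S.smul_mem hT z, fun a => by simp [h]⟩
  have hsa : ∀ s ∈ 𝓜.alg.commutant, IsSelfAdjoint s → P s := by
    intro s hs hs'
    have h1 := exists_commutant_dual_pos hξ hΨ hμ
      (show algebraMap ℂ (H →L[ℂ] H) ‖s‖ - s ∈ 𝓜.alg.commutant from
        sub_mem (S.algebraMap_mem _) hs) (isPositive_norm_sub hs')
    have h2 := exists_commutant_dual_pos hξ hΨ hμ
      (show algebraMap ℂ (H →L[ℂ] H) ‖s‖ ∈ 𝓜.alg.commutant from S.algebraMap_mem _)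
      (isPositive_algebraMap (norm_nonneg _))
    have h3 := hadd _ _ h2 (hsmul (-1) _ h1)
    rwa [neg_one_smul, ← sub_eq_add_neg, sub_sub_cancel] at h3
  have hre : ((realPart b : selfAdjoint (H →L[ℂ] H)) : H →L[ℂ] H) ∈ 𝓜.alg.commutant := by
    rw [realPart_apply_coe]
    exact real_smul_mem _ (add_mem hb (star_mem hb))
  have him : ((imaginaryPart b : selfAdjoint (H →L[ℂ] H)) : H →L[ℂ] H) ∈ 𝓜.alg.commutant := by
    rw [imaginaryPart_apply_coe]
    exact S.smul_mem (real_smul_mem _ (sub_mem hb (star_mem hb))) _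
  have := hadd _ _ (hsa _ hre (realPart b).2) (hsmul Complex.I _ (hsa _ him (imaginaryPart b).2))
  rwa [realPart_add_I_smul_imaginaryPart] at this

theorem eq_zero_of_mem_commutant (hξ : 𝓜.IsStandardVector ξ) {y : H →L[ℂ] H}
    (hy : y ∈ 𝓜.alg.commutant) (h : y ξ = 0) : y = 0 := by
  ext z
  refine hξ.cyclic.induction_on z (isClosed_eq (by fun_prop) (by fun_prop)) fun a => ?_
  have := DFunLike.congr_fun (VonNeumannAlgebra.mem_commutant_iff.1 hy _ a.2) ξ
  change (a : H →L[ℂ] H) (y ξ) = y ((a : H →L[ℂ] H) ξ) at this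
  rw [← this, h]
  simp

theorem twist_separating (hξ : 𝓜.IsStandardVector ξ) (x : 𝓜.twist.Elem)
    (h : (x : H →L[ℂ] H) ξ = 0) : x = 0 := by
  have hΓx : 𝓜.Γ ((x : H →L[ℂ] H) (𝓜.Γ ξ)) = 0 := by
    rcases hξ.even with he | he <;> simp [he, h]
  have e0 : ((𝓜.twist.evenElem x : 𝓜.twist.Elem) : H →L[ℂ] H) ξ = 0 := by
    change ((2⁻¹ : ℂ) • ((x : H →L[ℂ] H) + 𝓜.Γ * x * 𝓜.Γ)) ξ = 0
    simp [h, hΓx]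
  have e1 : ((𝓜.twist.oddElem x : 𝓜.twist.Elem) : H →L[ℂ] H) ξ = 0 := by
    change ((2⁻¹ : ℂ) • ((x : H →L[ℂ] H) - 𝓜.Γ * x * 𝓜.Γ)) ξ = 0
    simp [h, hΓx]
  have z0 := eq_zero_of_mem_commutant hξ (𝓜.twist_even_mem (𝓜.twist.evenElem x).2) e0
  have z1 := eq_zero_of_mem_commutant hξ (𝓜.twist_odd_mem (𝓜.twist.oddElem x).2)
    (by rw [mul_apply_eq_comp, e1, map_zero])
  have z1' : ((𝓜.twist.oddElem x : 𝓜.twist.Elem) : H →L[ℂ] H) = 0 := by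
    have := congrArg (𝓜.Γ * ·) z1
    simpa [← mul_assoc, 𝓜.Γ_mul_Γ] using this
  rw [← 𝓜.twist.evenElem_add_oddElem x]
  apply Subtype.ext
  rw [AddMemClass.coe_add, z0, z1']
  simp

/-- An element `x` of `M^≀` is determined by the functional `a ↦ ⟨x a ξ, ξ⟩` on `M`. -/
theorem twist_ext (hξ : 𝓜.IsStandardVector ξ) {x y : 𝓜.twist.Elem}
    (h : ∀ a : 𝓜.Elem, inner ℂ ξ ((x : H →L[ℂ] H) ((a : H →L[ℂ] H) ξ)) =
      inner ℂ ξ ((y : H →L[ℂ] H) ((a : H →L[ℂ] H) ξ))) : x = y := by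
  have h1 : ((star x : 𝓜.twist.Elem) : H →L[ℂ] H) ξ = ((star y : 𝓜.twist.Elem) : H →L[ℂ] H) ξ := by
    change ContinuousLinearMap.adjoint (x : H →L[ℂ] H) ξ =
      ContinuousLinearMap.adjoint (y : H →L[ℂ] H) ξ
    refine ext_inner_right ℂ fun z => ?_
    refine hξ.cyclic.induction_on z (isClosed_eq (by fun_prop) (by fun_prop)) fun a => ?_
    rw [ContinuousLinearMap.adjoint_inner_left, ContinuousLinearMap.adjoint_inner_left, h]
  have h2 := twist_separating hξ (star x - star y) (by
    rw [AddSubgroupClass.coe_sub, sub_apply, h1, sub_self])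
  exact star_injective (sub_eq_zero.1 h2)

theorem exists_twisted_dual_apply (hξ : 𝓜.IsStandardVector ξ) {Ψ : 𝓜.Elem →ₗ[ℂ] 𝓜.Elem}
    (hΨ : 𝓜.IsPositiveMap Ψ) (hμ : ∀ a, 𝓜.vectorState ξ (Ψ a) = 𝓜.vectorState ξ a)
    (b : 𝓜.twist.Elem) :
    ∃ T : 𝓜.twist.Elem, ∀ a : 𝓜.Elem, inner ℂ ξ ((T : H →L[ℂ] H) ((a : H →L[ℂ] H) ξ)) =
      inner ℂ ξ ((b : H →L[ℂ] H) ((Ψ a : H →L[ℂ] H) ξ)) := by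
  -- a version of the Klein transformation adapted to the sign in `Γξ = ±ξ`
  obtain ⟨k, hk1, hk2, hk⟩ : ∃ k : (H →L[ℂ] H) → (H →L[ℂ] H),
      (∀ y ∈ 𝓜.alg.commutant, k y ∈ 𝓜.twist.alg) ∧
      (∀ x ∈ 𝓜.twist.alg, k x ∈ 𝓜.alg.commutant) ∧
      ∀ x z, inner ℂ ξ (k x z) = inner ℂ ξ (x z) := by
    have hadj : ∀ z : H, inner ℂ ξ (𝓜.Γ z) = inner ℂ (𝓜.Γ ξ) z := by
      intro z
      have : ContinuousLinearMap.adjoint 𝓜.Γ = 𝓜.Γ := 𝓜.star_Γ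
      rw [← ContinuousLinearMap.adjoint_inner_left, this]
    rcases hξ.even with he | he
    · refine ⟨klein 𝓜.Γ, fun y hy => ⟨y, hy, rfl⟩, fun x hx => 𝓜.mem_twistedCommutant.1 hx,
        fun x z => ?_⟩
      conv_rhs => rw [← evenPart_add_oddPart (Γ := 𝓜.Γ) x]
      simp only [klein, add_apply, mul_apply_eq_comp,
        inner_add_right, hadj, he]
    · refine ⟨fun x => klein 𝓜.Γ (𝓜.Γ * x * 𝓜.Γ), fun y hy => ⟨_, 𝓜.commutant_stable y hy, rfl⟩,
        fun x hx => 𝓜.mem_twistedCommutant.1 (𝓜.twist.stable x hx), fun x z => ?_⟩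
      have h1 : 𝓜.Γ * x * 𝓜.Γ = evenPart 𝓜.Γ x + -oddPart 𝓜.Γ x := by
        simp only [evenPart, oddPart]; module
      dsimp only
      rw [h1, klein_eq (conj_evenPart 𝓜.Γ_mul_Γ x)
        (by rw [mul_neg, neg_mul, conj_oddPart 𝓜.Γ_mul_Γ])]
      conv_rhs => rw [← evenPart_add_oddPart (Γ := 𝓜.Γ) x]
      simp only [add_apply, mul_apply_eq_comp,
        neg_apply, inner_add_right, hadj, he, inner_neg_left, inner_neg_right,
        neg_neg]
  obtain ⟨T, hT, h⟩ := exists_commutant_dual hξ hΨ hμ (hk2 b b.2)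
  refine ⟨⟨k T, hk1 T hT⟩, fun a => ?_⟩
  change inner ℂ ξ (k T _) = _
  rw [hk, h, hk]

/-- Existence and uniqueness of the twisted dual of a positive map that preserves `μ`. -/
theorem existsUnique_isTwistedDual (hξ : 𝓜.IsStandardVector ξ) {Ψ : 𝓜.Elem →ₗ[ℂ] 𝓜.Elem}
    (hΨ : 𝓜.IsPositiveMap Ψ) (hμ : ∀ a, 𝓜.vectorState ξ (Ψ a) = 𝓜.vectorState ξ a) :
    ∃! Φ : 𝓜.twist.Elem →ₗ[ℂ] 𝓜.twist.Elem, 𝓜.IsTwistedDual ξ Ψ Φ := by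
  choose f hf using exists_twisted_dual_apply hξ hΨ hμ
  refine ⟨{ toFun := f, map_add' := fun b c => ?_, map_smul' := fun z b => ?_ },
    fun a b => hf b a, fun Φ hΦ => LinearMap.ext fun b => twist_ext hξ fun a => ?_⟩
  · refine twist_ext hξ fun a => ?_
    simp [hf]
  · refine twist_ext hξ fun a => ?_
    simp [hf]
  · exact (hΦ a b).trans (hf b a).symm

end Existence

/-- The twisted dual `Ψ^≀ : M^≀ → M^≀` of a positive map `Ψ : M → M` with `μ ∘ Ψ = μ`. -/
def twistedDual {𝓜 : GradedVonNeumannAlgebra H} {ξ : H} (hξ : 𝓜.IsStandardVector ξ)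
    {Ψ : 𝓜.Elem →ₗ[ℂ] 𝓜.Elem} (hΨ : 𝓜.IsPositiveMap Ψ)
    (hμ : ∀ a, 𝓜.vectorState ξ (Ψ a) = 𝓜.vectorState ξ a) :
    𝓜.twist.Elem →ₗ[ℂ] 𝓜.twist.Elem :=
  (existsUnique_isTwistedDual hξ hΨ hμ).choose

theorem isTwistedDual_twistedDual {𝓜 : GradedVonNeumannAlgebra H} {ξ : H}
    (hξ : 𝓜.IsStandardVector ξ) {Ψ : 𝓜.Elem →ₗ[ℂ] 𝓜.Elem} (hΨ : 𝓜.IsPositiveMap Ψ)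
    (hμ : ∀ a, 𝓜.vectorState ξ (Ψ a) = 𝓜.vectorState ξ a) :
    𝓜.IsTwistedDual ξ Ψ (twistedDual hξ hΨ hμ) :=
  (existsUnique_isTwistedDual hξ hΨ hμ).choose_spec.1

/-- The copy `Ψ^ϰ = ϰ ∘ Ψ ∘ ϰ⁻¹ : M^≀ → M^≀` of `Ψ` along a `*`-isomorphism `ϰ : M → M^≀`. -/
def copy {𝓜 : GradedVonNeumannAlgebra H} (ϰ : 𝓜.Elem ≃⋆ₐ[ℂ] 𝓜.twist.Elem)
    (Ψ : 𝓜.Elem →ₗ[ℂ] 𝓜.Elem) : 𝓜.twist.Elem →ₗ[ℂ] 𝓜.twist.Elem where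
  toFun b := ϰ (Ψ (ϰ.symm b))
  map_add' b c := by simp
  map_smul' z b := by simp

/-- Fermionic standard quantum detailed balance of `Ψ` with respect to `μ` and `ϰ`: the map `Ψ`
preserves `μ`, so that its twisted dual is defined, and `Ψ^≀ = Ψ^ϰ`. -/
def FermionicDetailedBalance {𝓜 : GradedVonNeumannAlgebra H} {ξ : H} (hξ : 𝓜.IsStandardVector ξ)
    (ϰ : 𝓜.Elem ≃⋆ₐ[ℂ] 𝓜.twist.Elem) {Ψ : 𝓜.Elem →ₗ[ℂ] 𝓜.Elem} (hΨ : 𝓜.IsPositiveMap Ψ) : Prop :=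
  ∃ hμ : ∀ a, 𝓜.vectorState ξ (Ψ a) = 𝓜.vectorState ξ a, twistedDual hξ hΨ hμ = copy ϰ Ψ

end GradedVonNeumannAlgebra

end

/-! ### Adjoints, the diagonal state and the copy of `Ψ`. -/

namespace GradedVonNeumannAlgebra

variable {H : Type u} [NormedAddCommGroup H] [InnerProductSpace ℂ H] [CompleteSpace H]
  {𝓜 : GradedVonNeumannAlgebra H} {ξ : H}

/-! Detailed balance and symmetry of `δ_ξ` are nearly the same identity, except that the two factors
appear in opposite orders. The twisted dual is tested on `⟨b a ξ, ξ⟩`, with the element of `M^≀` on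
the left, whereas `δ_ξ` evaluates `⟨a b ξ, ξ⟩`. Since `M` and `M^≀` commute only up to a sign,
exchanging the factors directly would require splitting into homogeneous parts and knowing how `Ψ`
and `ϰ` act on the grading. Neither map is assumed to respect it.

Taking adjoints reverses the order without any sign: `⟨a* b* ξ, ξ⟩` is the complex conjugate of `⟨b
a ξ, ξ⟩` (`diagonalState_ftmul_star`). A positive map preserves the involution
(`map_star_of_positive`), and hence so does its copy under `ϰ` (`copy_star`). The symmetry of `δ_ξ`
at `(a*, b*)` is therefore the complex conjugate of the twisted-dual identity for `Ψ^ϰ` at `(a, b)`.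
As the pair runs over `M × M^≀`, so does the pair of adjoints, which gives `isTwistedDual_copy_iff`.

It remains to pass between the statements that `Ψ^ϰ` satisfies the identity defining the twisted
dual and that `Ψ` is in detailed balance. The latter also includes `μ ∘ Ψ = μ`, which the symmetry
yields at `b = 1` because `Ψ^ϰ` is unital (`vectorState_eq_of_diagonalState_eq`). Once `μ` is
invariant, `existsUnique_isTwistedDual` applies. Existence there is a Radon-Nikodym argument: for
positive `b` in the commutant, `x ↦ ⟨b Ψ(x) ξ, ξ⟩` is a positive functional dominated by `‖b‖ μ`,
and a Klein transformation carries the resulting operator to `M^≀`. Uniqueness holds because `ξ`,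
being cyclic for `M` and an eigenvector of `Γ`, is separating for `M^≀`. -/

/-- The copy of a positive map along a `*`-isomorphism preserves the involution. -/
theorem copy_star (ϰ : 𝓜.Elem ≃⋆ₐ[ℂ] 𝓜.twist.Elem) {Ψ : 𝓜.Elem →ₗ[ℂ] 𝓜.Elem}
    (hΨ : 𝓜.IsPositiveMap Ψ) (b : 𝓜.twist.Elem) : copy ϰ Ψ (star b) = star (copy ϰ Ψ b) := by
  change ϰ (Ψ (ϰ.symm (star b))) = star (ϰ (Ψ (ϰ.symm b)))
  -- Only the middle rewrite needs positivity: a self-adjoint `s` is the difference of the positive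
  -- elements `‖s‖ • 1` and `‖s‖ • 1 - s`, so `Ψ s` is again self-adjoint. The outer two use that
  -- `ϰ` and its inverse are `*`-maps.
  rw [map_star, map_star_of_positive hΨ, map_star]

/-- Needed to evaluate the symmetry of the diagonal state at `b = 1`. -/
theorem copy_one (ϰ : 𝓜.Elem ≃⋆ₐ[ℂ] 𝓜.twist.Elem) {Ψ : 𝓜.Elem →ₗ[ℂ] 𝓜.Elem}
    (hΨ1 : Ψ 1 = 1) : copy ϰ Ψ 1 = 1 := by
  change ϰ (Ψ (ϰ.symm 1)) = 1
  rw [map_one, hΨ1, map_one]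

/-- The diagonal state at `a* ⓕ b*` is the complex conjugate of `⟨baξ, ξ⟩`. -/
theorem diagonalState_ftmul_star (a : 𝓜.Elem) (b : 𝓜.twist.Elem) :
    𝓜.diagonalState ξ (ftmul (star a) (star b)) =
      starRingEnd ℂ (inner ℂ ξ ((b : H →L[ℂ] H) ((a : H →L[ℂ] H) ξ))) := by
  -- On the right, conjugation swaps the two slots and leaves `b a ξ` in the first one. On the left,
  -- the two adjoints are then moved over one at a time, `a*` before `b*`, and this builds the
  -- product `b a` in the same slot.
  rw [diagonalState_ftmul, inner_conj_symm]
  change inner ℂ ξ (ContinuousLinearMap.adjoint (a : H →L[ℂ] H)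
    (ContinuousLinearMap.adjoint (b : H →L[ℂ] H) ξ)) = _
  rw [ContinuousLinearMap.adjoint_inner_right, ContinuousLinearMap.adjoint_inner_right]

/-- For a positive map, being twisted dual to the copy is a symmetry of the diagonal state. -/
theorem isTwistedDual_copy_iff (ϰ : 𝓜.Elem ≃⋆ₐ[ℂ] 𝓜.twist.Elem) {Ψ : 𝓜.Elem →ₗ[ℂ] 𝓜.Elem}
    (hΨ : 𝓜.IsPositiveMap Ψ) :
    𝓜.IsTwistedDual ξ Ψ (copy ϰ Ψ) ↔ ∀ (a : 𝓜.Elem) (b : 𝓜.twist.Elem),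
      𝓜.diagonalState ξ (ftmul a (copy ϰ Ψ b)) = 𝓜.diagonalState ξ (ftmul (Ψ a) b) := by
  -- The diagonal condition is taken at the adjoints, where it becomes an equality of complex
  -- conjugates of the two sides of the twisted-dual identity at `(a, b)`. Injectivity of
  -- conjugation then gives an equivalence for each pair separately.
  have key : ∀ (a : 𝓜.Elem) (b : 𝓜.twist.Elem),
      𝓜.diagonalState ξ (ftmul (star a) (copy ϰ Ψ (star b))) =
          𝓜.diagonalState ξ (ftmul (Ψ (star a)) (star b)) ↔
        inner ℂ ξ ((copy ϰ Ψ b : H →L[ℂ] H) ((a : H →L[ℂ] H) ξ)) =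
          inner ℂ ξ ((b : H →L[ℂ] H) ((Ψ a : H →L[ℂ] H) ξ)) := fun a b => by
    rw [copy_star ϰ hΨ, map_star_of_positive hΨ, diagonalState_ftmul_star,
      diagonalState_ftmul_star]
    exact (starRingEnd ℂ).injective.eq_iff
  -- The involution is a bijection on each algebra, so the pairwise equivalence at adjoints covers
  -- all pairs. In the forward direction it is used at `(a*, b*)`, and the double stars cancel.
  refine ⟨fun h a b => ?_, fun h a b => (key a b).1 (h _ _)⟩
  simpa only [star_star] using (key (star a) (star b)).2 (h _ _)

/-- Invariance of `μ` is built into detailed balance but is not visible in the symmetry condition.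
It is the special case in which the `M^≀` factor is trivial on both sides. -/
theorem vectorState_eq_of_diagonalState_eq (ϰ : 𝓜.Elem ≃⋆ₐ[ℂ] 𝓜.twist.Elem)
    {Ψ : 𝓜.Elem →ₗ[ℂ] 𝓜.Elem} (hΨ1 : Ψ 1 = 1)
    (h : ∀ (a : 𝓜.Elem) (b : 𝓜.twist.Elem),
      𝓜.diagonalState ξ (ftmul a (copy ϰ Ψ b)) = 𝓜.diagonalState ξ (ftmul (Ψ a) b))
    (a : 𝓜.Elem) : 𝓜.vectorState ξ (Ψ a) = 𝓜.vectorState ξ a := by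
  -- Unitality of `Ψ` turns the left factor `Ψ^ϰ(1)` into `1`, so the two sides become `μ(a)` and
  -- `μ(Ψ(a))`.
  have h1 := h a 1
  rw [copy_one ϰ hΨ1, diagonalState_ftmul, diagonalState_ftmul] at h1
  exact h1.symm

end GradedVonNeumannAlgebra

/-! ### The equivalence. -/

theorem mainTheorem12 {H : Type u} [NormedAddCommGroup H] [InnerProductSpace ℂ H] [CompleteSpace H]
    (𝓜 : GradedVonNeumannAlgebra H) (ξ : H) (hξ : 𝓜.IsStandardVector ξ)
    (ϰ : 𝓜.Elem ≃⋆ₐ[ℂ] 𝓜.twist.Elem)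
    (Ψ : 𝓜.Elem →ₗ[ℂ] 𝓜.Elem) (hΨ : 𝓜.IsPositiveMap Ψ) (hΨ1 : Ψ 1 = 1) :
    GradedVonNeumannAlgebra.FermionicDetailedBalance hξ ϰ hΨ ↔
      ∀ (a : 𝓜.Elem) (b : 𝓜.twist.Elem),
        𝓜.diagonalState ξ (GradedVonNeumannAlgebra.ftmul a (GradedVonNeumannAlgebra.copy ϰ Ψ b)) =
          𝓜.diagonalState ξ (GradedVonNeumannAlgebra.ftmul (Ψ a) b) := by
  -- With the factors reordered, the claim is that detailed balance holds exactly when `Ψ^ϰ`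
  -- satisfies the identity characterizing the twisted dual.
  rw [← GradedVonNeumannAlgebra.isTwistedDual_copy_iff ϰ hΨ]
  constructor
  · rintro ⟨hμ, h⟩
    rw [← h]
    exact GradedVonNeumannAlgebra.isTwistedDual_twistedDual hξ hΨ hμ
  · intro h
    -- Invariance has to come first, since `twistedDual` is only defined for a map that preserves
    -- `μ`. It is read off from the symmetric form of the hypothesis.
    have hμ := GradedVonNeumannAlgebra.vectorState_eq_of_diagonalState_eq ϰ hΨ1
      ((GradedVonNeumannAlgebra.isTwistedDual_copy_iff ϰ hΨ).1 h)
    -- Both `Ψ^≀` and `Ψ^ϰ` satisfy the same defining identity, so uniqueness forces them to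
    -- coincide.
    exact ⟨hμ, (GradedVonNeumannAlgebra.existsUnique_isTwistedDual hξ hΨ hμ).unique
      (GradedVonNeumannAlgebra.isTwistedDual_twistedDual hξ hΨ hμ) h⟩
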